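/- Let $\mathcal A=(\mathcal P,\mathcal L,\mathcal I)$ be a Desargues affine plane: any two distinct points lie on exactly one line; for every line $\ell$ and point $P\notin\ell$ exactly one line through $P$ misses $\ell$; there are three non-collinear points; and if $a,b,c$ are three distinct lines that are mutually parallel or have a common point, $A\neq B\neq C\neq A$ and $A'\neq B'\neq C'\neq A'$ with $A,A'\in a$, $B,B'\in b$, $C,C'\in c$, and the lines satisfy $AB\parallel A'B'$, $AB\ne A'B'$, $BC\parallel B'C'$, $BC\neq B'C'$, then $AC\parallel A'C'$. (Lines are parallel if they are equal or disjoint.) For distinct points $O,I$ on a line $\ell=\ell^{OI}$ the product $A\cdot B$ of $A,B\in\ell$ is the following point $C\in\ell$: choose $B_1\notin\ell$, let $P_1$ be the intersection of $OB_1$ with the parallel to $IB_1$ through $A$, and let $C$ be the intersection of $\ell$ with the parallel to $BB_1$ through $P_1$. For $B\ne O$, let $B^{-1}$ be the inverse of $B$ for this product, with unit $I$ (that is, $B\cdot B^{-1}=B^{-1}\cdot B=I$). The ratio of $A,B\in\ell$, $B\neq O$, is the point $r(A:B)=r_{O,I}(A:B)=B^{-1}\cdot A$ of $\ell$. A parallel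 projection between lines $\ell_1,\ell_2$ is a bijection $P_P:\ell_1\to\ell_2$ such that the lines $A\,P_P(A)$ and $B\,P_P(B)$ are parallel for all $A,B\in\ell_1$ with $A\neq P_P(A)$ and $B\ne P_P(B)$; if $\ell_1=\ell_2$ it is moreover required to be the restriction of a translation of the plane (the identity, or a collineation without fixed points that maps each line to a parallel line). **Theorem.** Let $P_P:\ell_1\to\ell_2$ be a parallel projection between two lines of a Desargues affine plane, let $O\neq I$ be points of $\ell_1$, and let $A,B\in\ell_1$ with $B\neq O$. Then the ratio $r_{O,I}(A:B)$ on $\ell_1$ and the ratio $r_{P_P(O),P_P(I)}(P_P(A):P_P(B))$ on $\ell_2$ are well defined (they exist and do not depend on the auxiliary points), and $$P_P\bigl(r_{O,I}(A:B)\bigr)=r_{P_P(O),P_P(I)}\bigl(P_P(A):P_P(B)\bigr).$$ -/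

import Mathlib

namespace DesarguesGeometry

/-- Two lines are parallel when they are equal or have no common point. -/
def Parallel {P L : Type*} [Membership P L] (l m : L) : Prop :=
  l = m ∨ ∀ p : P, p ∈ l → p ∉ m

/-- The points of a line. -/
abbrev Pts {P L : Type*} [Membership P L] (l : L) : Type _ := {p : P // p ∈ l}

/-- Affine planes: points `P`, lines `L`, incidence given by `∈`. -/
class IsAffinePlane (P L : Type*) [Membership P L] : Prop where
  existsUnique_line : ∀ p q : P, p ≠ q → ∃! l : L, p ∈ l ∧ q ∈ l
  playfair : ∀ (p : P) (l : L), p ∉ l → ∃! m : L, p ∈ m ∧ ∀ q : P, q ∈ l → q ∉ m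
  exists_noncollinear : ∃ p q r : P, ¬ ∃ l : L, p ∈ l ∧ q ∈ l ∧ r ∈ l

/-- Desargues affine planes: for three distinct lines `a, b, c` that are parallel or pass through a
common point, and triangles `ABC`, `A'B'C'` with corresponding vertices on `a, b, c`, if the lines
`AB ≠ A'B'` are parallel and the lines `BC ≠ B'C'` are parallel, then `AC` and `A'C'` are
parallel. -/
class IsDesarguesPlane (P L : Type*) [Membership P L] : Prop extends IsAffinePlane P L where
  desargues : ∀ (a b c : L) (A A' B B' C C' : P) (AB A'B' BC B'C' AC A'C' : L),
    a ≠ b → b ≠ c → a ≠ c →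
    ((Parallel a b ∧ Parallel b c) ∨ ∃ p : P, p ∈ a ∧ p ∈ b ∧ p ∈ c) →
    A ∈ a → A' ∈ a → B ∈ b → B' ∈ b → C ∈ c → C' ∈ c →
    A ≠ B → A' ≠ B' → B ≠ C → B' ≠ C' → A ≠ C → A' ≠ C' →
    A ∈ AB → B ∈ AB → A' ∈ A'B' → B' ∈ A'B' →
    B ∈ BC → C ∈ BC → B' ∈ B'C' → C' ∈ B'C' →
    A ∈ AC → C ∈ AC → A' ∈ A'C' → C' ∈ A'C' →
    AB ≠ A'B' → BC ≠ B'C' →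
    Parallel AB A'B' → Parallel BC B'C' → Parallel AC A'C'

section LineArithmetic

variable {P L : Type*} [Membership P L] {l : L}

/-- `C = A · B` on the line `l` with zero `O` and unit `I`: for an auxiliary point `B₁` off `l`, the
parallel to `I B₁` through `A` meets the line `O B₁` in `P₁`, and the parallel to `B B₁` through
`P₁` meets `l` in `C`. -/
def IsMul (O I A B C : Pts l) : Prop :=
  ∃ B₁ P₁ : P, ∃ IB₁ OB₁ BB₁ m n : L,
    B₁ ∉ l ∧
    (I : P) ∈ IB₁ ∧ B₁ ∈ IB₁ ∧
    (O : P) ∈ OB₁ ∧ B₁ ∈ OB₁ ∧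
    (B : P) ∈ BB₁ ∧ B₁ ∈ BB₁ ∧
    (A : P) ∈ m ∧ Parallel m IB₁ ∧ P₁ ∈ m ∧ P₁ ∈ OB₁ ∧
    P₁ ∈ n ∧ Parallel n BB₁ ∧ (C : P) ∈ n

/-- `X = B⁻¹` on the line `l` with zero `O` and unit `I`. -/
def IsInv (O I B X : Pts l) : Prop :=
  IsMul O I B X I ∧ IsMul O I X B I

/-- `R = B⁻¹ · A` on the line `l` with zero `O` and unit `I`. -/
def IsRatio (O I A B R : Pts l) : Prop :=
  ∃ X : Pts l, IsInv O I B X ∧ IsMul O I X A R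

open Classical in
/-- The ratio `r(A : B) = B⁻¹ · A` on the line `l` with zero `O` and unit `I`: the unique point `R`
with `IsRatio O I A B R` (and the irrelevant value `O` if there is no such unique point). -/
noncomputable def ratio (O I A B : Pts l) : Pts l :=
  if h : ∃! R : Pts l, IsRatio O I A B R then h.choose else O

end LineArithmetic

/-- Dilatations: collineations that send every line to a parallel line. -/
def IsDilatation {P : Type*} (L : Type*) [Membership P L] (τ : Equiv.Perm P) : Prop :=
  ∀ l : L, ∃ m : L, Parallel m l ∧ ∀ p : P, p ∈ l ↔ τ p ∈ m

/-- Translations: the identity, and the dilatations without fixed points. -/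
def IsTranslation {P : Type*} (L : Type*) [Membership P L] (τ : Equiv.Perm P) : Prop :=
  IsDilatation L τ ∧ (τ = 1 ∨ ∀ p : P, τ p ≠ p)

/-- Parallel projections `f` from the line `l₁` to the line `l₂`: bijections for which the lines
joining a point `A ≠ f A` to its image are all parallel. If `l₁ = l₂`, that condition is void, and
the parallel projections of the line to itself are the restrictions of translations. -/
structure IsParallelProjection {P L : Type*} [Membership P L] (l₁ l₂ : L)
    (f : Pts l₁ → Pts l₂) : Prop where
  bijective : Function.Bijective f
  parallel : ∀ (A B : Pts l₁) (m n : L), (A : P) ≠ f A → (B : P) ≠ f B →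
    (A : P) ∈ m → (f A : P) ∈ m → (B : P) ∈ n → (f B : P) ∈ n → Parallel m n
  translation_of_eq : l₁ = l₂ →
    ∃ τ : Equiv.Perm P, IsTranslation L τ ∧ ∀ A : Pts l₁, (f A : P) = τ A

end DesarguesGeometry

/-!
Multiplication by `A` on a line through `O` and `I` is the homothety with centre `O` that sends `I`
to `A`; the auxiliary points `B₁` and `P₁` of the construction are a point off the line and its
image under that homothety. All steps are phrased with `SameDir`, the parallelism of two pairs of
points, which becomes vacuous when the points of one pair coincide; with it Desargues' axiom turns
into the statements `SameDir.of_concurrent` and `SameDir.of_parallel`, in which the primed triangle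
may degenerate.

* Applying `SameDir.of_concurrent` twice shows that the product does not depend on the auxiliary
  point (`MulVia.change`), so the product is a function. Exchanging the roles of `B₁` and `P₁` turns
  a right inverse into a left inverse, so two-sided inverses exist without any appeal to
  associativity. Hence ratios exist and are unique (`existsUnique_isRatio`).
* A parallel projection preserves products (`IsParallelProjection.isMul`). If the two lines
  coincide, it extends to a dilatation, which carries the whole construction along. Otherwise it
  projects along a direction `d` that is parallel to neither line, and it factors through the
  parallel to `l₂` through `O`. The first factor fixes `O`, and an auxiliary point common to both
  lines makes `SameDir.of_concurrent` applicable (`LineMul.of_projAlong_fixed`). The second factor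
  is a projection between parallel lines, and moving the auxiliary points along `d` as well makes
  `SameDir.of_parallel` applicable (`LineMul.of_projAlong_parallel`).

A map that preserves products preserves inverses and ratios, and the uniqueness of ratios concludes.
-/

namespace DesarguesGeometry

/-! ### Incidence and parallelism in affine planes -/

section Affine

variable {P L : Type*} [Membership P L]

theorem Parallel.refl (l : L) : Parallel l l := Or.inl rfl

theorem Parallel.symm {l m : L} (h : Parallel l m) : Parallel m l := by
  rcases h with rfl | h
  · exact Or.inl rfl
  · exact Or.inr fun p hm hl => h p hl hm

theorem Parallel.eq_of_mem {l m : L} {p : P} (h : Parallel l m) (hl : p ∈ l) (hm : p ∈ m) :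
    l = m := by
  rcases h with h | h
  · exact h
  · exact absurd hm (h p hl)

theorem exists_inter {l m : L} (h : ¬ Parallel l m) : ∃ p : P, p ∈ l ∧ p ∈ m := by
  by_contra hno
  exact h (Or.inr fun p hl hm => hno ⟨p, hl, hm⟩)

variable [IsAffinePlane P L]

theorem line_eq {p q : P} {l m : L} (h : p ≠ q) (hpl : p ∈ l) (hql : q ∈ l) (hpm : p ∈ m)
    (hqm : q ∈ m) : l = m :=
  (IsAffinePlane.existsUnique_line p q h).unique ⟨hpl, hql⟩ ⟨hpm, hqm⟩

theorem point_eq {p q : P} {l m : L} (h : l ≠ m) (hpl : p ∈ l) (hql : q ∈ l) (hpm : p ∈ m)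
    (hqm : q ∈ m) : p = q := by
  by_contra hpq
  exact h (line_eq hpq hpl hql hpm hqm)

variable (L) in
theorem exists_line {p q : P} (h : p ≠ q) : ∃ l : L, p ∈ l ∧ q ∈ l :=
  (IsAffinePlane.existsUnique_line p q h).exists

theorem exists_parallel (p : P) (l : L) : ∃ m : L, p ∈ m ∧ Parallel m l := by
  by_cases hp : p ∈ l
  · exact ⟨l, hp, Parallel.refl l⟩
  · obtain ⟨m, hm, hml⟩ := (IsAffinePlane.playfair p l hp).exists
    exact ⟨m, hm, Or.inr fun q hqm hql => hml q hql hqm⟩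

theorem Parallel.trans {l m n : L} (h₁ : Parallel l m) (h₂ : Parallel m n) : Parallel l n := by
  by_contra hno
  obtain ⟨p, hl, hn⟩ := exists_inter hno
  by_cases hp : p ∈ m
  · exact hno (Or.inl ((h₁.eq_of_mem hl hp).trans (h₂.eq_of_mem hp hn)))
  · refine hno (Or.inl ((IsAffinePlane.playfair p m hp).unique ⟨hl, fun q hm hq => ?_⟩
      ⟨hn, fun q hm hq => ?_⟩))
    · exact hp (h₁.eq_of_mem hq hm ▸ hl)
    · exact hp (h₂.eq_of_mem hm hq ▸ hn)

theorem exists_not_mem (l : L) : ∃ p : P, p ∉ l := by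
  by_contra! hno
  obtain ⟨p, q, r, h⟩ := IsAffinePlane.exists_noncollinear (P := P) (L := L)
  exact h ⟨l, hno p, hno q, hno r⟩

/-- The fourth vertex of a parallelogram lies on neither side through the opposite vertex. -/
theorem exists_not_mem_two {l k : L} {O I B : P} (hOl : O ∈ l) (hIl : I ∈ l) (hOk : O ∈ k)
    (hBk : B ∈ k) (hOI : O ≠ I) (hB : B ∉ l) : ∃ X : P, X ∉ l ∧ X ∉ k := by
  obtain ⟨s, hIs, hsk⟩ := exists_parallel I k
  obtain ⟨t, hBt, htl⟩ := exists_parallel B l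
  have hkl : k ≠ l := fun h => hB (h ▸ hBk)
  have hIk : I ∉ k := fun h => hkl (line_eq hOI hOk h hOl hIl)
  have hst : ¬ Parallel s t := fun h =>
    hkl (((hsk.symm.trans h).trans htl).eq_of_mem hOk hOl)
  obtain ⟨X, hXs, hXt⟩ := exists_inter hst
  exact ⟨X, fun h => hB (htl.eq_of_mem hXt h ▸ hBt), fun h => hIk (hsk.eq_of_mem hXs h ▸ hIs)⟩

end Affine

/-! ### Parallel pairs of points and projections along a direction -/

/-- The pairs `X, Y` and `X', Y'` lie on parallel lines. If `X ≠ Y` and `X' ≠ Y'`, this says that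
the lines `XY` and `X'Y'` are parallel; if `X' = Y'`, it holds for all `X ≠ Y`. -/
def SameDir {P : Type*} (L : Type*) [Membership P L] (X Y X' Y' : P) : Prop :=
  ∃ l m : L, X ∈ l ∧ Y ∈ l ∧ X' ∈ m ∧ Y' ∈ m ∧ Parallel l m

/-- `X'` lies on the line through `X` parallel to `d`. -/
def ProjAlong {P L : Type*} [Membership P L] (d : L) (X X' : P) : Prop :=
  ∃ m : L, X ∈ m ∧ X' ∈ m ∧ Parallel m d

section SameDir

variable {P L : Type*} [Membership P L]

theorem SameDir.symm {X Y X' Y' : P} (h : SameDir L X Y X' Y') : SameDir L X' Y' X Y := by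
  obtain ⟨l, m, h₁, h₂, h₃, h₄, h₅⟩ := h
  exact ⟨m, l, h₃, h₄, h₁, h₂, h₅.symm⟩

theorem SameDir.swap {X Y X' Y' : P} (h : SameDir L X Y X' Y') : SameDir L Y X Y' X' := by
  obtain ⟨l, m, h₁, h₂, h₃, h₄, h₅⟩ := h
  exact ⟨l, m, h₂, h₁, h₄, h₃, h₅⟩

theorem ProjAlong.symm {d : L} {X X' : P} (h : ProjAlong d X X') : ProjAlong d X' X := by
  obtain ⟨m, h₁, h₂, h₃⟩ := h
  exact ⟨m, h₂, h₁, h₃⟩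

variable [IsAffinePlane P L]

theorem SameDir.degenerate {X Y : P} (h : X ≠ Y) (Z : P) : SameDir L X Y Z Z := by
  obtain ⟨l, hX, hY⟩ := exists_line L h
  obtain ⟨m, hZ, hm⟩ := exists_parallel Z l
  exact ⟨l, m, hX, hY, hZ, hZ, hm.symm⟩

theorem SameDir.trans {X Y X' Y' X'' Y'' : P} (hne : X' ≠ Y') (h₁ : SameDir L X Y X' Y')
    (h₂ : SameDir L X' Y' X'' Y'') : SameDir L X Y X'' Y'' := by
  obtain ⟨l, m, a₁, a₂, a₃, a₄, a₅⟩ := h₁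
  obtain ⟨m', n, b₁, b₂, b₃, b₄, b₅⟩ := h₂
  obtain rfl := line_eq hne a₃ a₄ b₁ b₂
  exact ⟨l, n, a₁, a₂, b₃, b₄, a₅.trans b₅⟩

theorem SameDir.exists_parallel_line {X Y X' Y' : P} {l : L} (h : SameDir L X Y X' Y')
    (hne : X ≠ Y) (hX : X ∈ l) (hY : Y ∈ l) : ∃ m : L, X' ∈ m ∧ Y' ∈ m ∧ Parallel m l := by
  obtain ⟨l', m, h₁, h₂, h₃, h₄, h₅⟩ := h
  obtain rfl := line_eq hne h₁ h₂ hX hY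
  exact ⟨m, h₃, h₄, h₅.symm⟩

/-- A line meets the parallel to any line transversal to it. -/
theorem exists_mem_sameDir {X Y : P} {k : L} (hX : X ∉ k) (hY : Y ∈ k) (Z : P) :
    ∃ Q ∈ k, SameDir L X Y Z Q := by
  obtain ⟨l, hXl, hYl⟩ := exists_line L (p := X) (q := Y) fun h => hX (h ▸ hY)
  obtain ⟨m, hZ, hml⟩ := exists_parallel Z l
  have hmk : ¬ Parallel m k := fun h => hX ((hml.symm.trans h).eq_of_mem hYl hY ▸ hXl)
  obtain ⟨Q, hQm, hQk⟩ := exists_inter hmk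
  exact ⟨Q, hQk, l, m, hXl, hYl, hZ, hQm, hml.symm⟩

theorem SameDir.right_unique {X Y Z Q Q' : P} {k : L} (hX : X ∉ k) (hY : Y ∈ k) (hQ : Q ∈ k)
    (hQ' : Q' ∈ k) (h : SameDir L X Y Z Q) (h' : SameDir L X Y Z Q') : Q = Q' := by
  have hne : X ≠ Y := fun h => hX (h ▸ hY)
  obtain ⟨l, hXl, hYl⟩ := exists_line L hne
  obtain ⟨m, hZm, hQm, hml⟩ := h.exists_parallel_line hne hXl hYl
  obtain ⟨m', hZm', hQm', hml'⟩ := h'.exists_parallel_line hne hXl hYl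
  obtain rfl := (hml.trans hml'.symm).eq_of_mem hZm hZm'
  have hmk : m ≠ k := fun h => hX ((h ▸ hml).eq_of_mem hY hYl ▸ hXl)
  exact point_eq hmk hQm hQm' hQ hQ'

theorem SameDir.mem_of_mem {X Y X' Y' : P} {k : L} (h : SameDir L X Y X' Y') (hne : X ≠ Y)
    (hX : X ∈ k) (hY : Y ∈ k) (hX' : X' ∈ k) : Y' ∈ k := by
  obtain ⟨m, h₁, h₂, h₃⟩ := h.exists_parallel_line hne hX hY
  exact h₃.eq_of_mem h₁ hX' ▸ h₂

theorem exists_projAlong {d k : L} (h : ¬ Parallel d k) (X : P) : ∃ X' ∈ k, ProjAlong d X X' := by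
  obtain ⟨m, hXm, hmd⟩ := exists_parallel X d
  obtain ⟨X', hX'm, hX'k⟩ := exists_inter fun hmk => h (hmd.symm.trans hmk)
  exact ⟨X', hX'k, m, hXm, hX'm, hmd⟩

theorem ProjAlong.trans {d : L} {X X' X'' : P} (h : ProjAlong d X X') (h' : ProjAlong d X' X'') :
    ProjAlong d X X'' := by
  obtain ⟨m, h₁, h₂, h₃⟩ := h
  obtain ⟨m', h₁', h₂', h₃'⟩ := h'
  obtain rfl := (h₃.trans h₃'.symm).eq_of_mem h₂ h₁'
  exact ⟨m, h₁, h₂', h₃⟩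

theorem ProjAlong.eq_of_mem {d k : L} {X X' : P} (hd : ¬ Parallel d k) (h : ProjAlong d X X')
    (hX : X ∈ k) (hX' : X' ∈ k) : X = X' := by
  obtain ⟨m, h₁, h₂, h₃⟩ := h
  exact point_eq (l := m) (m := k) (fun hmk => hd (hmk ▸ h₃.symm)) h₁ h₂ hX hX'

theorem ProjAlong.sameDir {d : L} {X X' Y Y' : P} (h : ProjAlong d X X') (h' : ProjAlong d Y Y') :
    SameDir L X X' Y Y' := by
  obtain ⟨m, h₁, h₂, h₃⟩ := h
  obtain ⟨m', h₁', h₂', h₃'⟩ := h'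
  exact ⟨m, m', h₁, h₂, h₁', h₂', h₃.trans h₃'.symm⟩

end SameDir

/-! ### Desargues' axiom for degenerate triangles -/

section Desargues

variable {P L : Type*} [Membership P L] [IsDesarguesPlane P L]

/-- Desargues' axiom without the requirement that the parallel sides differ: if one of the sides
`XY`, `YZ` equals its image, then the two triangles coincide. -/
theorem SameDir.desargues {a b c : L} {X X' Y Y' Z Z' : P} (hab : a ≠ b) (hbc : b ≠ c) (hac : a ≠ c)
    (habc : (Parallel a b ∧ Parallel b c) ∨ ∃ p : P, p ∈ a ∧ p ∈ b ∧ p ∈ c)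
    (hX : X ∈ a) (hX' : X' ∈ a) (hY : Y ∈ b) (hY' : Y' ∈ b) (hZ : Z ∈ c) (hZ' : Z' ∈ c)
    (hXb : X ∉ b) (hYa : Y ∉ a) (hYc : Y ∉ c) (hZb : Z ∉ b) (hXZ : X ≠ Z)
    (hXY' : X' ≠ Y') (hYZ' : Y' ≠ Z') (hXZ' : X' ≠ Z')
    (h₁ : SameDir L X Y X' Y') (h₂ : SameDir L Y Z Y' Z') : SameDir L X Z X' Z' := by
  have hXY : X ≠ Y := fun h => hXb (h ▸ hY)
  have hYZ : Y ≠ Z := fun h => hYc (h ▸ hZ)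
  obtain ⟨r, hXr, hZr⟩ := exists_line L hXZ
  obtain ⟨r', hXr', hZr'⟩ := exists_line L hXZ'
  have key : X = X' → Z = Z' → SameDir L X Z X' Z' := fun e₁ e₂ =>
    ⟨r, r, hXr, hZr, e₁ ▸ hXr, e₂ ▸ hZr, Parallel.refl r⟩
  obtain ⟨p, p', p₁, p₂, p₃, p₄, p₅⟩ := h₁
  obtain ⟨q, q', q₁, q₂, q₃, q₄, q₅⟩ := h₂
  have hpa : p ≠ a := fun h => hYa (h ▸ p₂)
  have hpb : p ≠ b := fun h => hXb (h ▸ p₁)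
  have hqb : q ≠ b := fun h => hZb (h ▸ q₂)
  have hqc : q ≠ c := fun h => hYc (h ▸ q₁)
  by_cases hp : p = p'
  · subst hp
    have eX : X = X' := point_eq hpa p₁ p₃ hX hX'
    have eY : Y = Y' := point_eq hpb p₂ p₄ hY hY'
    obtain rfl := q₅.eq_of_mem q₁ (eY ▸ q₃)
    exact key eX (point_eq hqc q₂ q₄ hZ hZ')
  by_cases hq : q = q'
  · subst hq
    have eZ : Z = Z' := point_eq hqc q₂ q₄ hZ hZ'
    have eY : Y = Y' := point_eq hqb q₁ q₃ hY hY'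
    exact absurd (p₅.eq_of_mem p₂ (eY ▸ p₄)) hp
  exact ⟨r, r', hXr, hZr, hXr', hZr', IsDesarguesPlane.desargues a b c X X' Y Y' Z Z' p p' q q' r r'
    hab hbc hac habc hX hX' hY hY' hZ hZ' hXY hXY' hYZ hYZ' hXZ hXZ' p₁ p₂ p₃ p₄ q₁ q₂ q₃ q₄
    hXr hZr hXr' hZr' hp hq p₅ q₅⟩

/-- Desargues' axiom for triangles in perspective from `O`; the second one may shrink to `O`. -/
theorem SameDir.of_concurrent {a b c : L} {O X X' Y Y' Z Z' : P}
    (hab : a ≠ b) (hbc : b ≠ c) (hac : a ≠ c) (hOa : O ∈ a) (hOb : O ∈ b) (hOc : O ∈ c)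
    (hX : X ∈ a) (hX' : X' ∈ a) (hY : Y ∈ b) (hY' : Y' ∈ b) (hZ : Z ∈ c) (hZ' : Z' ∈ c)
    (hXO : X ≠ O) (hYO : Y ≠ O) (hZO : Z ≠ O)
    (h₁ : SameDir L X Y X' Y') (h₂ : SameDir L Y Z Y' Z') : SameDir L X Z X' Z' := by
  have hXb : X ∉ b := fun h => hXO (point_eq hab hX hOa h hOb)
  have hYa : Y ∉ a := fun h => hYO (point_eq hab h hOa hY hOb)
  have hYc : Y ∉ c := fun h => hYO (point_eq hbc hY hOb h hOc)
  have hZb : Z ∉ b := fun h => hZO (point_eq hbc h hOb hZ hOc)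
  have hXZ : X ≠ Z := fun h => hXO (point_eq hac hX hOa (h ▸ hZ) hOc)
  have hXY : X ≠ Y := fun h => hXb (h ▸ hY)
  have hYZ : Y ≠ Z := fun h => hYc (h ▸ hZ)
  -- If one vertex of the second triangle is `O`, then all three are.
  have eXY : X' = O → Y' = O := fun h => by
    subst h
    exact SameDir.right_unique hXb hY hY' hOb h₁ (.degenerate hXY _)
  have eYX : Y' = O → X' = O := fun h => by
    subst h
    exact SameDir.right_unique hYa hX hX' hOa h₁.swap (.degenerate hXY.symm _)
  have eYZ : Y' = O → Z' = O := fun h => by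
    subst h
    exact SameDir.right_unique hYc hZ hZ' hOc h₂ (.degenerate hYZ _)
  by_cases hYO' : Y' = O
  · rw [eYX hYO', eYZ hYO']
    exact .degenerate hXZ O
  · refine SameDir.desargues hab hbc hac (Or.inr ⟨O, hOa, hOb, hOc⟩) hX hX' hY hY' hZ hZ' hXb hYa hYc
      hZb hXZ (fun h => ?_) (fun h => ?_) (fun h => ?_) h₁ h₂
    · exact hYO' (point_eq hab (h ▸ hX') hOa hY' hOb)
    · exact hYO' (point_eq hbc hY' hOb (h ▸ hZ') hOc)
    · exact hYO' (eXY (point_eq hac hX' hOa (h ▸ hZ') hOc))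

/-- Desargues' axiom for triangles with vertices on parallel lines; the lines `a` and `c` may
coincide. -/
theorem SameDir.of_parallel {a b c : L} {X X' Y Y' Z Z' : P}
    (hab : a ≠ b) (hbc : b ≠ c) (pab : Parallel a b) (pbc : Parallel b c)
    (hX : X ∈ a) (hX' : X' ∈ a) (hY : Y ∈ b) (hY' : Y' ∈ b) (hZ : Z ∈ c) (hZ' : Z' ∈ c)
    (h₁ : SameDir L X Y X' Y') (h₂ : SameDir L Y Z Y' Z') : SameDir L X Z X' Z' := by
  by_cases hac : a = c
  · subst hac
    exact ⟨a, a, hX, hZ, hX', hZ', Parallel.refl a⟩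
  · exact SameDir.desargues hab hbc hac (Or.inl ⟨pab, pbc⟩) hX hX' hY hY' hZ hZ'
      (fun h => hab (pab.eq_of_mem hX h)) (fun h => hab (pab.eq_of_mem h hY))
      (fun h => hbc (pbc.eq_of_mem hY h)) (fun h => hbc (pbc.eq_of_mem h hZ))
      (fun h => hac ((pab.trans pbc).eq_of_mem hX (h ▸ hZ)))
      (fun h => hab (pab.eq_of_mem hX' (h ▸ hY'))) (fun h => hbc (pbc.eq_of_mem hY' (h ▸ hZ')))
      (fun h => hac ((pab.trans pbc).eq_of_mem hX' (h ▸ hZ'))) h₁ h₂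

end Desargues

/-! ### Products on a line -/

/-- `C = A · B` on a line with zero `O` and unit `I`, constructed with the auxiliary point `B₁`. -/
def MulVia {P : Type*} (L : Type*) [Membership P L] (O I A B C B₁ : P) : Prop :=
  ∃ (P₁ : P) (k : L), O ∈ k ∧ B₁ ∈ k ∧ P₁ ∈ k ∧ SameDir L I B₁ A P₁ ∧ SameDir L B B₁ C P₁

/-- `C = A · B` on the line `l` with zero `O` and unit `I`, for points of the plane. -/
def LineMul {P L : Type*} [Membership P L] (l : L) (O I A B C : P) : Prop :=
  ∃ B₁ : P, B₁ ∉ l ∧ MulVia L O I A B C B₁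

section Product

variable {P L : Type*} [Membership P L]

theorem isMul_iff_lineMul {l : L} {O I A B C : Pts l} :
    IsMul O I A B C ↔ LineMul l (O : P) I A B C := by
  constructor
  · rintro ⟨B₁, P₁, IB, OB, BB, m, n, h, h₁, h₂, h₃, h₄, h₅, h₆, h₇, h₈, h₉, h₁₀, h₁₁, h₁₂, h₁₃⟩
    exact ⟨B₁, h, P₁, OB, h₃, h₄, h₁₀, ⟨IB, m, h₁, h₂, h₇, h₉, h₈.symm⟩,
      ⟨BB, n, h₅, h₆, h₁₃, h₁₁, h₁₂.symm⟩⟩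
  · rintro ⟨B₁, h, P₁, OB, h₃, h₄, h₁₀, ⟨IB, m, h₁, h₂, h₇, h₉, h₈⟩, ⟨BB, n, h₅, h₆, h₁₃, h₁₁, h₁₂⟩⟩
    exact ⟨B₁, P₁, IB, OB, BB, m, n, h, h₁, h₂, h₃, h₄, h₅, h₆, h₇, h₈.symm, h₉, h₁₀, h₁₁, h₁₂.symm,
      h₁₃⟩

section

variable [IsAffinePlane P L] {l : L} {O I : P}

theorem MulVia.exists (hO : O ∈ l) (hI : I ∈ l) (hOI : O ≠ I) {B B₁ : P} (hB : B ∈ l) (hB₁ : B₁ ∉ l)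
    (A : P) : ∃ C ∈ l, MulVia L O I A B C B₁ := by
  obtain ⟨k, hOk, hB₁k⟩ := exists_line L (p := O) (q := B₁) fun h => hB₁ (h ▸ hO)
  have hIk : I ∉ k := fun h => hB₁ (line_eq hOI hOk h hO hI ▸ hB₁k)
  obtain ⟨P₁, hP₁, h₁⟩ := exists_mem_sameDir hIk hB₁k A
  obtain ⟨C, hC, h₂⟩ := exists_mem_sameDir hB₁ hB P₁
  exact ⟨C, hC, P₁, k, hOk, hB₁k, hP₁, h₁, h₂.swap⟩

/-- Two products with the same left factor and the same auxiliary point `B₁` also share the point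
`P₁`. -/
theorem MulVia.common_aux (hO : O ∈ l) (hI : I ∈ l) (hOI : O ≠ I) {A B B' C C' B₁ : P}
    (hB₁ : B₁ ∉ l) (h : MulVia L O I A B C B₁) (h' : MulVia L O I A B' C' B₁) :
    ∃ (P₁ : P) (k : L), O ∈ k ∧ B₁ ∈ k ∧ P₁ ∈ k ∧ SameDir L I B₁ A P₁ ∧ SameDir L B B₁ C P₁ ∧
      SameDir L B' B₁ C' P₁ := by
  obtain ⟨P₁, k, hOk, hB₁k, hP₁, h₁, h₂⟩ := h
  obtain ⟨P₂, k', hOk', hB₁k', hP₂, h₁', h₂'⟩ := h'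
  have hOB₁ : O ≠ B₁ := fun h => hB₁ (h ▸ hO)
  obtain rfl := line_eq hOB₁ hOk hB₁k hOk' hB₁k'
  have hIk : I ∉ k := fun h => hB₁ (line_eq hOI hOk h hO hI ▸ hB₁k)
  obtain rfl := SameDir.right_unique hIk hB₁k hP₁ hP₂ h₁ h₁'
  exact ⟨P₁, k, hOk, hB₁k, hP₁, h₁, h₂, h₂'⟩

theorem MulVia.unique (hO : O ∈ l) (hI : I ∈ l) (hOI : O ≠ I) {A B C C' B₁ : P} (hB : B ∈ l)
    (hC : C ∈ l) (hC' : C' ∈ l) (hB₁ : B₁ ∉ l) (h : MulVia L O I A B C B₁)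
    (h' : MulVia L O I A B C' B₁) : C = C' := by
  obtain ⟨P₁, k, -, -, -, -, h₂, h₃⟩ := h.common_aux hO hI hOI hB₁ h'
  exact SameDir.right_unique hB₁ hB hC hC' h₂.swap h₃.swap

theorem MulVia.right_cancel (hO : O ∈ l) (hI : I ∈ l) (hOI : O ≠ I) {A B B' C B₁ : P}
    (hAO : A ≠ O) (hA : A ∈ l) (hC : C ∈ l) (hB : B ∈ l) (hB' : B' ∈ l) (hB₁ : B₁ ∉ l)
    (h : MulVia L O I A B C B₁) (h' : MulVia L O I A B' C B₁) : B = B' := by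
  obtain ⟨P₁, k, hOk, hB₁k, hP₁, h₁, h₂, h₃⟩ := h.common_aux hO hI hOI hB₁ h'
  have hP₁l : P₁ ∉ l := fun hl => by
    have hkl : k ≠ l := fun e => hB₁ (e ▸ hB₁k)
    have e : P₁ = O := point_eq hkl hP₁ hOk hl hO
    exact hB₁ (h₁.symm.mem_of_mem (fun e' => hAO (e'.trans e)) hA hl hI)
  exact SameDir.right_unique hP₁l hC hB hB' h₂.symm.swap h₃.symm.swap

theorem MulVia.eq_zero_of_right (hO : O ∈ l) {I A C B₁ : P} (hC : C ∈ l) (hB₁ : B₁ ∉ l)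
    (h : MulVia L O I A O C B₁) : C = O := by
  have hB₁O : B₁ ≠ O := fun h => hB₁ (h ▸ hO)
  obtain ⟨P₁, k, hOk, hB₁k, hP₁, -, h₂⟩ := h
  have hCk : C ∈ k := h₂.swap.mem_of_mem hB₁O hB₁k hOk hP₁
  have hkl : k ≠ l := fun e => hB₁ (e ▸ hB₁k)
  exact point_eq hkl hCk hOk hC hO

end

end Product

section DesarguesProduct

variable {P L : Type*} [Membership P L] [IsDesarguesPlane P L] {l : L} {O I : P}

/-- The product does not depend on the auxiliary point, for auxiliary points on different lines
through `O`. -/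
theorem MulVia.change_of_not_mem (hO : O ∈ l) (hI : I ∈ l) (hOI : O ≠ I) {A B C B₁ B₂ : P} {k : L}
    (hA : A ∈ l) (hB : B ∈ l) (hC : C ∈ l) (hB₁ : B₁ ∉ l) (hB₂ : B₂ ∉ l) (hOk : O ∈ k) (hB₁k : B₁ ∈ k)
    (hB₂k : B₂ ∉ k) (h : MulVia L O I A B C B₁) : MulVia L O I A B C B₂ := by
  have hB₁O : B₁ ≠ O := fun h => hB₁ (h ▸ hO)
  have hB₂O : B₂ ≠ O := fun h => hB₂ (h ▸ hO)
  obtain ⟨j, hOj, hB₂j⟩ := exists_line L hB₂O.symm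
  have hIj : I ∉ j := fun h => hB₂ (line_eq hOI hOj h hO hI ▸ hB₂j)
  obtain ⟨P₂, hP₂, h₂⟩ := exists_mem_sameDir hIj hB₂j A
  by_cases hBO : B = O
  · subst hBO
    obtain rfl := h.eq_zero_of_right hO hC hB₁
    exact ⟨P₂, j, hOj, hB₂j, hP₂, h₂, j, j, hOj, hB₂j, hOj, hP₂, Parallel.refl j⟩
  obtain ⟨P₁, k', hOk', hB₁k', hP₁, h₁, h₃⟩ := h
  obtain rfl := line_eq hB₁O hB₁k hOk hB₁k' hOk'
  have hkl : k ≠ l := fun e => hB₁ (e ▸ hB₁k)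
  have hjl : j ≠ l := fun e => hB₂ (e ▸ hB₂j)
  have hkj : k ≠ j := fun e => hB₂k (e ▸ hB₂j)
  have h₄ : SameDir L B₁ B₂ P₁ P₂ := SameDir.of_concurrent hkl hjl.symm hkj hOk hO hOj hB₁k hP₁ hI hA
    hB₂j hP₂ hB₁O hOI.symm hB₂O h₁.swap h₂
  exact ⟨P₂, j, hOj, hB₂j, hP₂, h₂, SameDir.of_concurrent hkl.symm hkj hjl.symm hO hOk hOj hB hC hB₁k
    hP₁ hB₂j hP₂ hBO hB₁O hB₂O h₃ h₄⟩

/-- The product does not depend on the auxiliary point. Auxiliary points on the same line through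
`O` are compared by means of a third one off that line. -/
theorem MulVia.change (hO : O ∈ l) (hI : I ∈ l) (hOI : O ≠ I) {A B C B₁ B₂ : P} (hA : A ∈ l)
    (hB : B ∈ l) (hC : C ∈ l) (hB₁ : B₁ ∉ l) (hB₂ : B₂ ∉ l) (h : MulVia L O I A B C B₁) :
    MulVia L O I A B C B₂ := by
  have hB₂O : B₂ ≠ O := fun h => hB₂ (h ▸ hO)
  obtain ⟨k, hOk, hB₁k⟩ := exists_line L (p := O) (q := B₁) fun h => hB₁ (h ▸ hO)
  by_cases hB₂k : B₂ ∈ k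
  · obtain ⟨X, hXl, hXk⟩ := exists_not_mem_two hO hI hOk hB₁k hOI hB₁
    obtain ⟨j, hOj, hXj⟩ := exists_line L (p := O) (q := X) fun h => hXl (h ▸ hO)
    refine (h.change_of_not_mem hO hI hOI hA hB hC hB₁ hXl hOk hB₁k hXk).change_of_not_mem
      hO hI hOI hA hB hC hXl hB₂ hOj hXj fun h => ?_
    exact hXk (line_eq hB₂O h hOj hB₂k hOk ▸ hXj)
  · exact h.change_of_not_mem hO hI hOI hA hB hC hB₁ hB₂ hOk hB₁k hB₂k

theorem LineMul.mulVia (hO : O ∈ l) (hI : I ∈ l) (hOI : O ≠ I) {A B C B₁ : P} (hA : A ∈ l)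
    (hB : B ∈ l) (hC : C ∈ l) (hB₁ : B₁ ∉ l) (h : LineMul l O I A B C) : MulVia L O I A B C B₁ := by
  obtain ⟨B₂, hB₂, h⟩ := h
  exact h.change hO hI hOI hA hB hC hB₂ hB₁

end DesarguesProduct

/-! ### Inverses and ratios -/

theorem isRatio_ratio {P L : Type*} [Membership P L] {l : L} {O I A B : Pts l}
    (h : ∃! R, IsRatio O I A B R) :
    IsRatio O I A B (ratio O I A B) := by
  rw [ratio, dif_pos h]
  exact h.choose_spec.1

section Ratio

variable {P L : Type*} [Membership P L] [IsDesarguesPlane P L] {l : L} {O I : Pts l}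

theorem exists_isMul (hOI : O ≠ I) (A B : Pts l) : ∃ C, IsMul O I A B C := by
  obtain ⟨B₁, hB₁⟩ := exists_not_mem l
  obtain ⟨C, hC, h⟩ := MulVia.exists O.2 I.2 (Subtype.coe_injective.ne hOI) B.2 hB₁ (A : P)
  exact ⟨⟨C, hC⟩, isMul_iff_lineMul.2 ⟨B₁, hB₁, h⟩⟩

theorem IsMul.unique (hOI : O ≠ I) {A B C C' : Pts l} (h : IsMul O I A B C)
    (h' : IsMul O I A B C') : C = C' := by
  have hOI' := Subtype.coe_injective.ne hOI
  obtain ⟨B₁, hB₁, h⟩ := isMul_iff_lineMul.1 h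
  exact Subtype.ext (h.unique O.2 I.2 hOI' B.2 C.2 C'.2 hB₁
    ((isMul_iff_lineMul.1 h').mulVia O.2 I.2 hOI' A.2 B.2 C'.2 hB₁))

theorem IsMul.right_cancel (hOI : O ≠ I) {A B B' C : Pts l} (hA : A ≠ O) (h : IsMul O I A B C)
    (h' : IsMul O I A B' C) : B = B' := by
  have hOI' := Subtype.coe_injective.ne hOI
  obtain ⟨B₁, hB₁, h⟩ := isMul_iff_lineMul.1 h
  exact Subtype.ext (h.right_cancel O.2 I.2 hOI' (Subtype.coe_injective.ne hA) A.2 C.2 B.2 B'.2 hB₁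
    ((isMul_iff_lineMul.1 h').mulVia O.2 I.2 hOI' A.2 B'.2 C.2 hB₁))

/-- If `B · X = I` is constructed with the auxiliary points `B₁` and `P₁`, then the construction of
`X · B` with these points exchanged yields `I`. -/
theorem exists_isInv (hOI : O ≠ I) {B : Pts l} (hB : B ≠ O) : ∃ X, IsInv O I B X := by
  have hOI' := Subtype.coe_injective.ne hOI
  obtain ⟨B₁, hB₁⟩ := exists_not_mem l
  obtain ⟨k, hOk, hB₁k⟩ := exists_line L (p := (O : P)) (q := B₁) fun h => hB₁ (h ▸ O.2)
  have hIk : (I : P) ∉ k := fun h => hB₁ (line_eq hOI' hOk h O.2 I.2 ▸ hB₁k)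
  obtain ⟨P₁, hP₁, h₁⟩ := exists_mem_sameDir hIk hB₁k (B : P)
  have hP₁l : P₁ ∉ l := fun hl => by
    have hkl : k ≠ l := fun e => hB₁ (e ▸ hB₁k)
    have e : P₁ = O := point_eq hkl hP₁ hOk hl O.2
    exact hB₁ (h₁.symm.mem_of_mem (fun e' => hB (Subtype.ext (e'.trans e))) B.2 hl I.2)
  obtain ⟨X, hX, h₂⟩ := exists_mem_sameDir hP₁l I.2 B₁
  exact ⟨⟨X, hX⟩, isMul_iff_lineMul.2 ⟨B₁, hB₁, P₁, k, hOk, hB₁k, hP₁, h₁, h₂.symm.swap⟩,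
    isMul_iff_lineMul.2 ⟨P₁, hP₁l, B₁, k, hOk, hP₁, hB₁k, h₂.swap, h₁.symm⟩⟩

theorem existsUnique_isRatio (hOI : O ≠ I) (A : Pts l) {B : Pts l} (hB : B ≠ O) :
    ∃! R, IsRatio O I A B R := by
  obtain ⟨X, hX⟩ := exists_isInv hOI hB
  obtain ⟨R, hR⟩ := exists_isMul hOI X A
  refine ⟨R, ⟨X, hX, hR⟩, fun R' ⟨X', hX', hR'⟩ => ?_⟩
  obtain rfl := hX.1.right_cancel hOI hB hX'.1
  exact hR'.unique hOI hR

end Ratio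

/-! ### Parallel projections preserve products -/

section Projection

variable {P L : Type*} [Membership P L]

theorem SameDir.map_dilatation [IsAffinePlane P L] {τ : Equiv.Perm P} (hτ : IsDilatation L τ)
    {X Y X' Y' : P} (h : SameDir L X Y X' Y') : SameDir L (τ X) (τ Y) (τ X') (τ Y') := by
  obtain ⟨l, m, h₁, h₂, h₃, h₄, h₅⟩ := h
  obtain ⟨l', hl, hl'⟩ := hτ l
  obtain ⟨m', hm, hm'⟩ := hτ m
  exact ⟨l', m', (hl' _).1 h₁, (hl' _).1 h₂, (hm' _).1 h₃, (hm' _).1 h₄,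
    (hl.trans h₅).trans hm.symm⟩

/-- A dilatation that maps the line `l` to itself preserves products on `l`. -/
theorem LineMul.map_dilatation [IsAffinePlane P L] {τ : Equiv.Perm P} (hτ : IsDilatation L τ)
    {l : L} (hl : ∀ p : P, p ∈ l → τ p ∈ l) {O I A B C : P} (hO : O ∈ l)
    (h : LineMul l O I A B C) : LineMul l (τ O) (τ I) (τ A) (τ B) (τ C) := by
  obtain ⟨B₁, hB₁, P₁, k, h₁, h₂, h₃, h₄, h₅⟩ := h
  obtain ⟨k', -, hk'⟩ := hτ k
  obtain ⟨l', hll', hl'⟩ := hτ l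
  obtain rfl := hll'.eq_of_mem ((hl' O).1 hO) (hl O hO)
  exact ⟨τ B₁, fun h => hB₁ ((hl' B₁).2 h), τ P₁, k', (hk' _).1 h₁, (hk' _).1 h₂, (hk' _).1 h₃,
    h₄.map_dilatation hτ, h₅.map_dilatation hτ⟩

variable [IsDesarguesPlane P L] {l l' d : L}

/-- A parallel projection between two lines through `O` that fixes `O` preserves products: an
auxiliary point off both lines serves for both products. -/
theorem LineMul.of_projAlong_fixed (hdl : ¬ Parallel d l) (hdl' : ¬ Parallel d l')
    {O I I' A A' B B' C C' : P} (hOI : O ≠ I) (hO : O ∈ l) (hO' : O ∈ l')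
    (hI : I ∈ l) (hI' : I' ∈ l') (hA : A ∈ l) (hA' : A' ∈ l') (hB : B ∈ l) (hB' : B' ∈ l')
    (hC : C ∈ l) (hC' : C' ∈ l') (pI : ProjAlong d I I') (pA : ProjAlong d A A')
    (pB : ProjAlong d B B') (pC : ProjAlong d C C') (h : LineMul l O I A B C) :
    LineMul l' O I' A' B' C' := by
  by_cases hll : l = l'
  · subst hll
    obtain rfl := pI.eq_of_mem hdl hI hI'
    obtain rfl := pA.eq_of_mem hdl hA hA'
    obtain rfl := pB.eq_of_mem hdl hB hB'
    obtain rfl := pC.eq_of_mem hdl hC hC'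
    exact h
  have hne : ∀ {X X' : P}, X ∈ l → X' ∈ l' → ProjAlong d X X' → X ≠ O → X' ≠ O := by
    rintro X X' hX hX' p hXO rfl
    exact hXO (p.eq_of_mem hdl hX hO)
  have hI'O := hne hI hI' pI hOI.symm
  have hI'l : I' ∉ l := fun h => hI'O (point_eq hll h hO hI' hO')
  obtain ⟨B₁, hB₁, hB₁'⟩ := exists_not_mem_two hO hI hO' hI' hOI hI'l
  obtain ⟨P₁, k, hOk, hB₁k, hP₁, h₁, h₂⟩ := h.mulVia hO hI hOI hA hB hC hB₁
  have hB₁O : B₁ ≠ O := fun h => hB₁ (h ▸ hO)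
  have hkl : k ≠ l := fun e => hB₁ (e ▸ hB₁k)
  have hkl' : k ≠ l' := fun e => hB₁' (e ▸ hB₁k)
  refine ⟨B₁, hB₁', P₁, k, hOk, hB₁k, hP₁, ?_, ?_⟩
  · exact SameDir.of_concurrent (Ne.symm hll) hkl.symm hkl'.symm hO' hO hOk hI' hA' hI hA hB₁k hP₁
      hI'O hOI.symm hB₁O (pI.sameDir pA).swap h₁
  · by_cases hBO : B = O
    · subst hBO
      obtain rfl : C = B := MulVia.eq_zero_of_right hO hC hB₁ ⟨P₁, k, hOk, hB₁k, hP₁, h₁, h₂⟩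
      obtain rfl := pB.eq_of_mem hdl' hO' hB'
      obtain rfl := pC.eq_of_mem hdl' hO' hC'
      exact ⟨k, k, hOk, hB₁k, hOk, hP₁, Parallel.refl k⟩
    · exact SameDir.of_concurrent (Ne.symm hll) hkl.symm hkl'.symm hO' hO hOk hB' hC' hB hC hB₁k hP₁
        (hne hB hB' pB hBO) hBO hB₁O (pB.sameDir pC).swap h₂

/-- Moving two lines `l` and `k` through `O` along `d` to parallel lines moves the line joining a
point of `l` to a point of `k` to a parallel one. -/
theorem SameDir.of_projAlong {k k' : L} {O O' X X' Y Y' : P} (hdl : ¬ Parallel d l)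
    (hdk : ¬ Parallel d k) (hll : Parallel l l') (hkk : Parallel k k') (hO : O ∈ l) (hO' : O' ∈ l')
    (hOk : O ∈ k) (hOk' : O' ∈ k') (hX : X ∈ l) (hX' : X' ∈ l') (hY : Y ∈ k) (hY' : Y' ∈ k')
    (pO : ProjAlong d O O') (pX : ProjAlong d X X') (pY : ProjAlong d Y Y') :
    SameDir L X Y X' Y' := by
  by_cases hXO : X = O
  · subst hXO
    obtain rfl := (pX.symm.trans pO).eq_of_mem (fun h => hdl (h.trans hll.symm)) hX' hO'
    exact ⟨k, k', hOk, hY, hOk', hY', hkk⟩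
  by_cases hYO : Y = O
  · subst hYO
    obtain rfl := (pY.symm.trans pO).eq_of_mem (fun h => hdk (h.trans hkk.symm)) hY' hOk'
    exact ⟨l, l', hX, hO, hX', hO', hll⟩
  obtain ⟨b, hb, hb', hbd⟩ := pO
  obtain ⟨a, ha, ha', had⟩ := pX
  obtain ⟨c, hc, hc', hcd⟩ := pY
  refine SameDir.of_parallel (a := a) (b := b) (c := c) ?_ ?_ (had.trans hbd.symm)
    (hbd.trans hcd.symm) ha ha' hb hb' hc hc' ⟨l, l', hX, hO, hX', hO', hll⟩
    ⟨k, k', hOk, hY, hOk', hY', hkk⟩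
  · rintro rfl
    exact hdl (line_eq hXO ha hb hX hO ▸ had.symm)
  · rintro rfl
    exact hdk (line_eq hYO hc hb hY hOk ▸ hbd.symm)

/-- A parallel projection between parallel lines preserves products: the auxiliary points are moved
along `d` as well. -/
theorem LineMul.of_projAlong_parallel (hdl : ¬ Parallel d l) (hll : Parallel l l')
    {O O' I I' A A' B B' C C' : P} (hOI : O ≠ I) (hO : O ∈ l) (hO' : O' ∈ l')
    (hI : I ∈ l) (hI' : I' ∈ l') (hA : A ∈ l) (hA' : A' ∈ l') (hB : B ∈ l) (hB' : B' ∈ l')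
    (hC : C ∈ l) (hC' : C' ∈ l') (pO : ProjAlong d O O') (pI : ProjAlong d I I')
    (pA : ProjAlong d A A') (pB : ProjAlong d B B') (pC : ProjAlong d C C')
    (h : LineMul l O I A B C) : LineMul l' O' I' A' B' C' := by
  have hdl' : ¬ Parallel d l' := fun h => hdl (h.trans hll.symm)
  -- The auxiliary point avoids `l` and the line `e` through `O` in direction `d`.
  obtain ⟨e, hOe, hed⟩ := exists_parallel O d
  have hel : ¬ Parallel e l := fun h => hdl (hed.symm.trans h)
  obtain ⟨Q, hQ⟩ := exists_not_mem l
  obtain ⟨E, hEe, m, hQm, hEm, hml⟩ := exists_projAlong (d := l) (fun h => hel h.symm) Q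
  have hEl : E ∉ l := fun h => hQ (hml.eq_of_mem hEm h ▸ hQm)
  obtain ⟨B₁, hB₁, hB₁e⟩ := exists_not_mem_two hO hI hOe hEe hOI hEl
  obtain ⟨P₁, k, hOk, hB₁k, hP₁, h₁, h₂⟩ := h.mulVia hO hI hOI hA hB hC hB₁
  have hkl : k ≠ l := fun e' => hB₁ (e' ▸ hB₁k)
  have hdk : ¬ Parallel d k := fun h => hB₁e ((hed.trans h).eq_of_mem hOe hOk ▸ hB₁k)
  obtain ⟨k', hOk', hkk⟩ := exists_parallel O' k
  have hdk' : ¬ Parallel d k' := fun h => hdk (h.trans hkk)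
  have hkl' : k' ≠ l' := fun h => hkl (((h ▸ hkk.symm).trans hll.symm).eq_of_mem hOk hO)
  obtain ⟨B₁', hB₁k', pB₁⟩ := exists_projAlong hdk' B₁
  obtain ⟨P₁', hP₁', pP₁⟩ := exists_projAlong hdk' P₁
  have hB₁' : B₁' ∉ l' := fun hmem => by
    obtain rfl := point_eq hkl' hB₁k' hOk' hmem hO'
    exact hB₁ ((pB₁.trans pO.symm).eq_of_mem hdk hB₁k hOk ▸ hO)
  -- The directions from points of `l` to points of `k` are preserved.
  have key : ∀ {X X' Y Y' : P}, X ∈ l → X' ∈ l' → Y ∈ k → Y' ∈ k' → ProjAlong d X X' →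
      ProjAlong d Y Y' → SameDir L X Y X' Y' := fun hX hX' hY hY' pX pY =>
    .of_projAlong hdl hdk hll hkk.symm hO hO' hOk hOk' hX hX' hY hY' pO pX pY
  have move : ∀ {X X' Z Z' : P}, X ∈ l → X' ∈ l' → Z ∈ l → Z' ∈ l' → ProjAlong d X X' →
      ProjAlong d Z Z' → SameDir L X B₁ Z P₁ → SameDir L X' B₁' Z' P₁' := by
    intro X X' Z Z' hX hX' hZ hZ' pX pZ hXZ
    have hXB₁ : X ≠ B₁ := fun e => hB₁ (e ▸ hX)
    have hXB₁' : X' ≠ B₁' := fun e => hB₁' (e ▸ hX')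
    by_cases hZP : Z = P₁
    · subst hZP
      obtain rfl := point_eq hkl hP₁ hOk hZ hO
      obtain rfl := (pZ.symm.trans pO).eq_of_mem hdl' hZ' hO'
      obtain rfl := (pP₁.symm.trans pO).eq_of_mem hdk' hP₁' hOk'
      exact .degenerate hXB₁' _
    · exact ((key hX hX' hB₁k hB₁k' pX pB₁).symm.trans hXB₁ hXZ).trans hZP
        (key hZ hZ' hP₁ hP₁' pZ pP₁)
  exact ⟨B₁', hB₁', P₁', k', hOk', hB₁k', hP₁', move hI hI' hA hA' pI pA h₁,
    move hB hB' hC hC' pB pC h₂⟩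

end Projection

section ParallelProjection

variable {P L : Type*} [Membership P L] {l₁ l₂ : L} {f : Pts l₁ → Pts l₂}

/-- A parallel projection between different lines projects along a direction that is parallel to
neither line. -/
theorem IsParallelProjection.exists_direction [IsAffinePlane P L]
    (hf : IsParallelProjection l₁ l₂ f) (hl : l₁ ≠ l₂) {O I : Pts l₁} (hOI : O ≠ I) :
    ∃ d : L, ¬ Parallel d l₁ ∧ ¬ Parallel d l₂ ∧ ∀ A : Pts l₁, ProjAlong d (A : P) (f A) := by
  have hOI' := Subtype.coe_injective.ne hOI
  have hfOI := Subtype.coe_injective.ne (hf.bijective.1.ne hOI)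
  obtain ⟨D, hD⟩ : ∃ D : Pts l₁, (D : P) ≠ f D := by
    by_contra! hno
    exact hl (line_eq hOI' O.2 I.2 (hno O ▸ (f O).2) (hno I ▸ (f I).2))
  obtain ⟨d, hd, hd'⟩ := exists_line L hD
  have hproj : ∀ A : Pts l₁, ProjAlong d (A : P) (f A) := fun A => by
    by_cases hA : (A : P) = f A
    · obtain ⟨m, hm, hmd⟩ := exists_parallel (A : P) d
      exact ⟨m, hm, hA ▸ hm, hmd⟩
    · obtain ⟨m, hm, hm'⟩ := exists_line L hA
      exact ⟨m, hm, hm', hf.parallel A D m d hA hD hm hm' hd hd'⟩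
  refine ⟨d, fun h => ?_, fun h => ?_, hproj⟩
  -- If `d` were parallel to one of the lines, then two points would lie on both lines.
  · have hmem : ∀ A : Pts l₁, (f A : P) ∈ l₁ := fun A => by
      obtain ⟨m, hm, hm', hmd⟩ := hproj A
      exact (hmd.trans h).eq_of_mem hm A.2 ▸ hm'
    exact hl (line_eq hfOI (hmem O) (hmem I) (f O).2 (f I).2)
  · have hmem : ∀ A : Pts l₁, (A : P) ∈ l₂ := fun A => by
      obtain ⟨m, hm, hm', hmd⟩ := hproj A
      exact (hmd.trans h).eq_of_mem hm' (f A).2 ▸ hm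
    exact hl (line_eq hOI' O.2 I.2 (hmem O) (hmem I))

theorem IsParallelProjection.isMul [IsDesarguesPlane P L] (hf : IsParallelProjection l₁ l₂ f)
    {O I A B C : Pts l₁} (hOI : O ≠ I) (h : IsMul O I A B C) :
    IsMul (f O) (f I) (f A) (f B) (f C) := by
  have hOI' := Subtype.coe_injective.ne hOI
  rw [isMul_iff_lineMul] at h ⊢
  by_cases hl : l₁ = l₂
  · subst hl
    obtain ⟨τ, ⟨hτ, -⟩, hfτ⟩ := hf.translation_of_eq rfl
    simp only [hfτ]
    exact h.map_dilatation hτ (fun p hp => hfτ ⟨p, hp⟩ ▸ (f ⟨p, hp⟩).2) O.2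
  obtain ⟨d, hd₁, hd₂, hp⟩ := hf.exists_direction hl hOI
  -- The projection is factored through the parallel `l` to `l₂` through `O`.
  obtain ⟨l, hOl, hll⟩ := exists_parallel (O : P) l₂
  have hdl : ¬ Parallel d l := fun h => hd₂ (h.trans hll)
  obtain ⟨I', hI', pI⟩ := exists_projAlong hdl (I : P)
  obtain ⟨A', hA', pA⟩ := exists_projAlong hdl (A : P)
  obtain ⟨B', hB', pB⟩ := exists_projAlong hdl (B : P)
  obtain ⟨C', hC', pC⟩ := exists_projAlong hdl (C : P)
  have hOI'' : (O : P) ≠ I' := by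
    rintro rfl
    exact hOI' (pI.symm.eq_of_mem hd₁ O.2 I.2)
  refine LineMul.of_projAlong_parallel hdl hll hOI'' hOl (f O).2 hI' (f I).2 hA' (f A).2 hB' (f B).2
    hC' (f C).2 (hp O) (pI.symm.trans (hp I)) (pA.symm.trans (hp A)) (pB.symm.trans (hp B))
    (pC.symm.trans (hp C)) ?_
  exact LineMul.of_projAlong_fixed hd₁ hdl hOI' O.2 hOl I.2 hI' A.2 hA' B.2 hB' C.2 hC' pI pA pB pC h

theorem IsParallelProjection.isRatio [IsDesarguesPlane P L] (hf : IsParallelProjection l₁ l₂ f)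
    {O I A B R : Pts l₁} (hOI : O ≠ I) (h : IsRatio O I A B R) :
    IsRatio (f O) (f I) (f A) (f B) (f R) := by
  obtain ⟨X, ⟨h₁, h₂⟩, h₃⟩ := h
  exact ⟨f X, ⟨hf.isMul hOI h₁, hf.isMul hOI h₂⟩, hf.isMul hOI h₃⟩

end ParallelProjection

end DesarguesGeometry

theorem mainTheorem4 {P L : Type*} [Membership P L] [DesarguesGeometry.IsDesarguesPlane P L]
    (l₁ l₂ : L) (f : DesarguesGeometry.Pts l₁ → DesarguesGeometry.Pts l₂)
    (hf : DesarguesGeometry.IsParallelProjection l₁ l₂ f)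
    (O I A B : DesarguesGeometry.Pts l₁) (hOI : O ≠ I) (hB : B ≠ O) :
    (∃! R, DesarguesGeometry.IsRatio O I A B R) ∧
    (∃! R', DesarguesGeometry.IsRatio (f O) (f I) (f A) (f B) R') ∧
    f (DesarguesGeometry.ratio O I A B) =
      DesarguesGeometry.ratio (f O) (f I) (f A) (f B) := by
  have hr := DesarguesGeometry.existsUnique_isRatio hOI A hB
  have hr' := DesarguesGeometry.existsUnique_isRatio (hf.bijective.1.ne hOI) (f A)
    (hf.bijective.1.ne hB)
  exact ⟨hr, hr', hr'.unique (hf.isRatio hOI (DesarguesGeometry.isRatio_ratio hr))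
    (DesarguesGeometry.isRatio_ratio hr')⟩
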